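/- Let $F$ be a free group with ordered basis $x_1<\dots<x_m$, let $e_1,\dots,e_m\ge 0$ be integers with $e_m\mid e_{m-1}\mid\cdots\mid e_1$, and let $\gamma_n(F)$ denote the $n$th term of the lower central series of $F$ (with $\gamma_1(F)=F$). Put $S=\langle x_1^{e_1},\dots,x_m^{e_m},\gamma_2(F)\rangle$, and let $R$ be a normal subgroup of $F$ with $R\gamma_2(F)=S$. In the integral group ring $\mathbb Z[F]$ let $\mathfrak f$ be the augmentation ideal and let $\mathfrak r$ be the two-sided ideal generated by the elements $r-1$, $r\in R$; for a two-sided ideal $\mathfrak a$ of $\mathbb Z[F]$ let $D(n,\mathfrak a)=F\cap(1+\mathfrak a+\mathfrak f^n)$. Then $D(4,\mathfrak f\mathfrak r\mathfrak f)$ is the subgroup of $F$ generated by $\gamma_4(F)$ together with all elements $[[x_j,x_i],x_k]^e$, where $1\le i<j\le m$, $1\le k\le m$, and $e\in\mathbb Z$ satisfies \begin{itemize} \item $e_i\mid e$, if $k\ne j$; \item $e_j\mid e$ and $e_i\mid 2e$, if $k=j$. \end{itemize} Here $[a,b]=aba^{-1}b^{-1}$. -/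

import Mathlib

open scoped commutatorElement

namespace GenDim

/-- `γ_n(G)`, the `n`-th term of the lower central series with the usual numbering
`γ_1(G) = G`, `γ_{n+1}(G) = [γ_n(G), G]` (Mathlib starts the series at `0`). -/
def gamma (G : Type*) [Group G] (n : ℕ) : Subgroup G :=
  (⊤ : Subgroup G).lowerCentralSeries (n - 1)

/-- The augmentation map `ℤ[G] → ℤ`, sending every group element to `1`. -/
noncomputable def augmentation (G : Type*) [Group G] : MonoidAlgebra ℤ G →ₐ[ℤ] ℤ :=
  MonoidAlgebra.lift ℤ ℤ G (1 : G →* ℤ)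

/-- The augmentation ideal of `ℤ[G]`. -/
noncomputable def augIdeal (G : Type*) [Group G] : Ideal (MonoidAlgebra ℤ G) :=
  RingHom.ker (augmentation G)

noncomputable instance augIdeal_isTwoSided (G : Type*) [Group G] :
    (augIdeal G).IsTwoSided :=
  inferInstanceAs (RingHom.ker (augmentation G)).IsTwoSided

/-- The ideal of `ℤ[G]` generated by the elements `g - 1`, `g ∈ R`. It is two-sided when `R` is
normal, see `relIdeal_isTwoSided`. -/
noncomputable def relIdeal {G : Type*} [Group G] (R : Subgroup G) : Ideal (MonoidAlgebra ℤ G) :=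
  Ideal.span {u | ∃ g ∈ R, u = MonoidAlgebra.of ℤ G g - 1}

instance relIdeal_isTwoSided {G : Type*} [Group G] (R : Subgroup G) [R.Normal] :
    (relIdeal R).IsTwoSided := by
  refine ⟨fun {a} b ha => ?_⟩
  induction b using MonoidAlgebra.induction_on with
  | of h =>
    unfold relIdeal at ha
    induction ha using Submodule.span_induction with
    | mem u hu =>
      obtain ⟨g, hg, rfl⟩ := hu
      have hc : h⁻¹ * g * h ∈ R := by
        simpa using (inferInstance : R.Normal).conj_mem g hg h⁻¹
      have heq : (MonoidAlgebra.of ℤ G g - 1) * MonoidAlgebra.of ℤ G h =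
          MonoidAlgebra.of ℤ G h * (MonoidAlgebra.of ℤ G (h⁻¹ * g * h) - 1) := by
        rw [sub_mul, mul_sub, ← map_mul, ← map_mul]
        simp [mul_assoc]
      rw [heq]
      exact Ideal.mul_mem_left _ _ (Ideal.subset_span ⟨_, hc, rfl⟩)
    | zero => simp
    | add u v _ _ hu hv => rw [add_mul]; exact add_mem hu hv
    | smul c u _ hu =>
      rw [smul_eq_mul, mul_assoc]
      exact Ideal.mul_mem_left _ _ hu
  | add u v hu hv => rw [mul_add]; exact add_mem hu hv
  | smul r u hu =>
    rw [mul_smul_comm]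
    exact zsmul_mem hu r

/-- The generalized dimension subgroup `D(n, 𝔞) = G ∩ (1 + 𝔞 + 𝔤ⁿ)`, where `𝔤` is the
augmentation ideal of `ℤ[G]`. -/
noncomputable def D {G : Type*} [Group G] (n : ℕ) (𝔞 : Ideal (MonoidAlgebra ℤ G)) :
    Subgroup G where
  carrier := {g | MonoidAlgebra.of ℤ G g - 1 ∈ 𝔞 ⊔ augIdeal G ^ n}
  one_mem' := by
    change MonoidAlgebra.of ℤ G 1 - 1 ∈ 𝔞 ⊔ augIdeal G ^ n
    rw [map_one, sub_self]; exact zero_mem _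
  mul_mem' := by
    intro g h hg hh
    have heq : MonoidAlgebra.of ℤ G (g * h) - 1 =
        MonoidAlgebra.of ℤ G g * (MonoidAlgebra.of ℤ G h - 1) + (MonoidAlgebra.of ℤ G g - 1) := by
      rw [map_mul, mul_sub]; simp
    change MonoidAlgebra.of ℤ G (g * h) - 1 ∈ 𝔞 ⊔ augIdeal G ^ n
    rw [heq]
    exact add_mem (Ideal.mul_mem_left _ _ hh) hg
  inv_mem' := by
    intro g hg
    have heq : MonoidAlgebra.of ℤ G g⁻¹ - 1 =
        -(MonoidAlgebra.of ℤ G g⁻¹ * (MonoidAlgebra.of ℤ G g - 1)) := by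
      rw [mul_sub, ← map_mul, inv_mul_cancel, map_one, mul_one, neg_sub]
    change MonoidAlgebra.of ℤ G g⁻¹ - 1 ∈ 𝔞 ⊔ augIdeal G ^ n
    rw [heq]
    exact neg_mem (Ideal.mul_mem_left _ _ hg)

end GenDim

/-! Everything is read off from Magnus coefficients of degree at most three. For a word of three
letters, a representation of `ℤ[F]` by upper triangular 4 × 4 matrices carries the coefficients of
its subwords, and `𝔣ᵏ` lands in the matrices vanishing below the k-th superdiagonal. An element of
`𝔣𝔯𝔣 + 𝔣⁴` has no coefficients of degree below 3, and its coefficient at a word is divisible by `e`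
of the middle letter, since modulo `𝔣²` the ideal `𝔯` is spanned by the e_q(x_q - 1)
(`dvd_magnusRep_of_mem`).

Hence if g lies in D(4, 𝔣𝔯𝔣), vanishing in degrees 1 and 2 puts g in γ_3. Modulo γ_4, g is then an
explicit combination of triple commutators whose exponents are its Magnus coefficients
(`lcsClass_eq_sum`). The triple commutators are chosen so that [[x_c,x_b],x_a] is read at the word
abc with c greatest, and [[x_a,x_b],x_b] at abb. The middle-letter divisibility is then the required
condition on the exponent. The condition e_i ∣ 2n for k = j comes from the relation c(bab) =
-2c(abb) between coefficients on γ_3 (`magnusEntry_symm`).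

Conversely, modulo `𝔣⁴` the n-th power of a triple commutator minus 1 is n times a Lie bracket of
the x_p - 1. Each monomial of its expansion lies in `𝔣𝔯𝔣 + 𝔣⁴` by divisibility at its middle letter
(`zsmul_mul_mul_mem`). -/

namespace GenDim

/-! ### Additive functions on the quotients of the lower central series -/

section GroupTheory

variable {F : Type*} [Group F]

lemma commutator_mem_lcs_succ {k : ℕ} {g : F}
    (hg : g ∈ (⊤ : Subgroup F).lowerCentralSeries k) (h : F) :
    ⁅g, h⁆ ∈ (⊤ : Subgroup F).lowerCentralSeries (k + 1) :=
  Subgroup.commutator_mem_commutator hg (Subgroup.mem_top h)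

lemma commutator_mem_lcs_succ' {k : ℕ} {g : F}
    (hg : g ∈ (⊤ : Subgroup F).lowerCentralSeries k) (h : F) :
    ⁅h, g⁆ ∈ (⊤ : Subgroup F).lowerCentralSeries (k + 1) := by
  rw [← commutatorElement_inv]
  exact inv_mem (commutator_mem_lcs_succ hg h)

/-- A function that restricts to a homomorphism `γ_{k+1}(F) / γ_{k+2}(F) → A`. -/
structure IsGraded {A : Type*} [AddCommGroup A] (k : ℕ) (f : F → A) : Prop where
  map_mul : ∀ g ∈ (⊤ : Subgroup F).lowerCentralSeries k,
    ∀ h ∈ (⊤ : Subgroup F).lowerCentralSeries k, f (g * h) = f g + f h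
  map_succ : ∀ g ∈ (⊤ : Subgroup F).lowerCentralSeries (k + 1), f g = 0

namespace IsGraded

variable {A : Type*} [AddCommGroup A] {k : ℕ} {f : F → A}

lemma map_one (hf : IsGraded k f) : f 1 = 0 := hf.map_succ 1 (one_mem _)

lemma map_inv (hf : IsGraded k f) {g : F} (hg : g ∈ (⊤ : Subgroup F).lowerCentralSeries k) :
    f g⁻¹ = -f g := by
  have h := hf.map_mul g hg g⁻¹ (inv_mem hg)
  rw [mul_inv_cancel, hf.map_one] at h
  exact (neg_eq_of_add_eq_zero_right h.symm).symm

lemma map_conj (hf : IsGraded k f) {t : F} (ht : t ∈ (⊤ : Subgroup F).lowerCentralSeries k)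
    (a : F) : f (a * t * a⁻¹) = f t := by
  have hc := commutator_mem_lcs_succ' ht a
  have h : a * t * a⁻¹ = ⁅a, t⁆ * t := by rw [commutatorElement_def]; group
  rw [h, hf.map_mul _ (Subgroup.lowerCentralSeries_antitone _ k.le_succ hc) _ ht,
    hf.map_succ _ hc, zero_add]

lemma commutator_left (hf : IsGraded (k + 1) f) (h : F) : IsGraded k fun g : F => f ⁅g, h⁆ where
  map_mul a ha b hb := by
    have e : ⁅a * b, h⁆ = (a * ⁅b, h⁆ * a⁻¹) * ⁅a, h⁆ := by
      simp only [commutatorElement_def]; group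
    have hb' := commutator_mem_lcs_succ hb h
    rw [e, hf.map_mul _ (Subgroup.Normal.conj_mem inferInstance _ hb' a) _
      (commutator_mem_lcs_succ ha h), hf.map_conj hb', add_comm]
  map_succ g hg := hf.map_succ _ (commutator_mem_lcs_succ hg h)

lemma map_commutator_mul (hf : IsGraded (k + 1) f) {g : F}
    (hg : g ∈ (⊤ : Subgroup F).lowerCentralSeries k) (a b : F) :
    f ⁅g, a * b⁆ = f ⁅g, a⁆ + f ⁅g, b⁆ := by
  have e : ⁅g, a * b⁆ = ⁅g, a⁆ * (a * ⁅g, b⁆ * a⁻¹) := by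
    simp only [commutatorElement_def]; group
  have hb' := commutator_mem_lcs_succ hg b
  rw [e, hf.map_mul _ (commutator_mem_lcs_succ hg a) _
    (Subgroup.Normal.conj_mem inferInstance _ hb' a), hf.map_conj hb']

lemma map_commutator_inv (hf : IsGraded (k + 1) f) {g : F}
    (hg : g ∈ (⊤ : Subgroup F).lowerCentralSeries k) (a : F) :
    f ⁅g, a⁻¹⁆ = -f ⁅g, a⁆ := by
  have h := hf.map_commutator_mul hg a a⁻¹
  rw [mul_inv_cancel, commutatorElement_one_right, hf.map_one] at h
  exact (neg_eq_of_add_eq_zero_right h.symm).symm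

lemma map_commutator_conj (hf : IsGraded (k + 1) f) {g : F}
    (hg : g ∈ (⊤ : Subgroup F).lowerCentralSeries k) (a b : F) :
    f ⁅g, a * b * a⁻¹⁆ = f ⁅g, b⁆ := by
  rw [hf.map_commutator_mul hg, hf.map_commutator_mul hg, hf.map_commutator_inv hg]
  abel

lemma eq_zero_of_zero (hf : IsGraded 0 f) {s : Set F} (hs : Subgroup.closure s = ⊤)
    (h : ∀ a ∈ s, f a = 0) (g : F) : f g = 0 := by
  have hg : g ∈ Subgroup.closure s := hs ▸ Subgroup.mem_top g
  induction hg using Subgroup.closure_induction with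
  | mem a ha => exact h a ha
  | one => exact hf.map_one
  | mul a b _ _ ha hb =>
    rw [hf.map_mul a (Subgroup.mem_top a) b (Subgroup.mem_top b), ha, hb, add_zero]
  | inv a _ ha => rw [hf.map_inv (Subgroup.mem_top a), ha, neg_zero]

/-- For fixed g in γ_{k+1}, the map q ↦ f ⁅g, q⁆ is additive, so generators suffice in the right
slot. With `commutator_left` this lowers the degree by one. -/
lemma eq_zero_of_commutator (hf : IsGraded (k + 1) f) {s : Set F}
    (hs : Subgroup.closure s = ⊤)
    (h : ∀ a ∈ s, ∀ g ∈ (⊤ : Subgroup F).lowerCentralSeries k, f ⁅g, a⁆ = 0)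
    {g : F} (hg : g ∈ (⊤ : Subgroup F).lowerCentralSeries (k + 1)) : f g = 0 := by
  have key : ∀ p ∈ (⊤ : Subgroup F).lowerCentralSeries k, ∀ q : F, f ⁅p, q⁆ = 0 := by
    intro p hp q
    have hq : q ∈ Subgroup.closure s := hs ▸ Subgroup.mem_top q
    induction hq using Subgroup.closure_induction with
    | mem a ha => exact h a ha p hp
    | one => rw [commutatorElement_one_right, hf.map_one]
    | mul a b _ _ ha hb => rw [hf.map_commutator_mul hp, ha, hb, add_zero]
    | inv a _ ha => rw [hf.map_commutator_inv hp, ha, neg_zero]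
  have hsub : ∀ y ∈ Subgroup.closure
      {y | ∃ p ∈ (⊤ : Subgroup F).lowerCentralSeries k, ∃ q ∈ (⊤ : Subgroup F), ⁅p, q⁆ = y},
      y ∈ (⊤ : Subgroup F).lowerCentralSeries (k + 1) := fun _ hy => hy
  rw [Subgroup.mem_lowerCentralSeries_succ_iff] at hg
  induction hg using Subgroup.closure_induction with
  | mem a ha =>
    obtain ⟨p, hp, q, -, rfl⟩ := ha
    exact key p hp q
  | one => exact hf.map_one
  | mul a b ha' hb' ha hb => rw [hf.map_mul a (hsub a ha') b (hsub b hb'), ha, hb, add_zero]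
  | inv a ha' ha => rw [hf.map_inv (hsub a ha'), ha, neg_zero]

lemma map_commutator_swap (hf : IsGraded 2 f) (a b c : F) :
    f ⁅⁅a, b⁆, c⁆ = -f ⁅⁅b, a⁆, c⁆ := by
  rw [← commutatorElement_inv b a]
  exact (hf.commutator_left c).map_inv
    (commutator_mem_lcs_succ (k := 0) (Subgroup.mem_top b) a)

lemma map_commutator_jacobi (hf : IsGraded 2 f) (a b c : F) :
    f ⁅⁅a, b⁆, c⁆ + f ⁅⁅b, c⁆, a⁆ + f ⁅⁅c, a⁆, b⁆ = 0 := by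
  have hm : ∀ u v : F, ⁅u, v⁆ ∈ (⊤ : Subgroup F).lowerCentralSeries 1 := fun u v =>
    commutator_mem_lcs_succ (k := 0) (Subgroup.mem_top u) v
  have hm' : ∀ u v w : F, ⁅⁅u, v⁆, w⁆ ∈ (⊤ : Subgroup F).lowerCentralSeries 2 := fun u v w =>
    commutator_mem_lcs_succ (hm u v) w
  -- A form of the Hall–Witt identity, valid in every group; `f` does not see the conjugations.
  have hw : ⁅⁅a, b⁆, b * c * b⁻¹⁆ * ⁅⁅b, c⁆, c * a * c⁻¹⁆ * ⁅⁅c, a⁆, a * b * a⁻¹⁆ = 1 := by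
    simp only [commutatorElement_def]; group
  have h := congrArg f hw
  rwa [hf.map_mul _ (mul_mem (hm' _ _ _) (hm' _ _ _)) _ (hm' _ _ _), hf.map_mul _ (hm' _ _ _) _ (hm' _ _ _),
    hf.map_commutator_conj (hm _ _), hf.map_commutator_conj (hm _ _),
    hf.map_commutator_conj (hm _ _), hf.map_one] at h

end IsGraded

/-- The quotient of consecutive terms of the lower central series. -/
abbrev LcsQuotient (F : Type*) [Group F] (k : ℕ) : Type _ :=
  (⊤ : Subgroup F).lowerCentralSeries k ⧸
    ((⊤ : Subgroup F).lowerCentralSeries (k + 1)).subgroupOf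
      ((⊤ : Subgroup F).lowerCentralSeries k)

instance lcsQuotientCommGroup (k : ℕ) : CommGroup (LcsQuotient F k) :=
  { (inferInstance : Group (LcsQuotient F k)) with
    mul_comm := by
      rintro ⟨a⟩ ⟨b⟩
      refine QuotientGroup.eq.2 ?_
      rw [Subgroup.mem_subgroupOf]
      have e : (((a * b)⁻¹ * (b * a) : (⊤ : Subgroup F).lowerCentralSeries k) : F) =
          ⁅(b : F)⁻¹, (a : F)⁻¹⁆ := by
        simp [commutatorElement_def, mul_assoc]
      change (((a * b)⁻¹ * (b * a) : (⊤ : Subgroup F).lowerCentralSeries k) : F) ∈ _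
      rw [e]
      exact commutator_mem_lcs_succ (inv_mem b.2) _ }

open Classical in
/-- The class of an element of `γ_{k+1}(F)` modulo `γ_{k+2}(F)` (zero off `γ_{k+1}(F)`). -/
noncomputable def lcsClass (k : ℕ) (g : F) : Additive (LcsQuotient F k) :=
  if h : g ∈ (⊤ : Subgroup F).lowerCentralSeries k then
    Additive.ofMul (QuotientGroup.mk' _ ⟨g, h⟩) else 0

lemma lcsClass_of_mem {k : ℕ} {g : F} (h : g ∈ (⊤ : Subgroup F).lowerCentralSeries k) :
    lcsClass k g = Additive.ofMul (QuotientGroup.mk' _ ⟨g, h⟩) := dif_pos h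

lemma lcsClass_eq_zero {k : ℕ} {g : F} (h : g ∈ (⊤ : Subgroup F).lowerCentralSeries k) :
    lcsClass k g = 0 ↔ g ∈ (⊤ : Subgroup F).lowerCentralSeries (k + 1) := by
  rw [lcsClass_of_mem h, ofMul_eq_zero, QuotientGroup.mk'_apply, QuotientGroup.eq_one_iff,
    Subgroup.mem_subgroupOf]

lemma isGraded_lcsClass (k : ℕ) : IsGraded k (lcsClass (F := F) k) where
  map_mul g hg h hh := by
    rw [lcsClass_of_mem hg, lcsClass_of_mem hh, lcsClass_of_mem (mul_mem hg hh), ← ofMul_mul,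
      ← map_mul]
    rfl
  map_succ g hg :=
    (lcsClass_eq_zero (Subgroup.lowerCentralSeries_antitone _ k.le_succ hg)).2 hg

lemma IsGraded.map_zpow {A : Type*} [AddCommGroup A] {k : ℕ} {f : F → A} (hf : IsGraded k f)
    {g : F} (hg : g ∈ (⊤ : Subgroup F).lowerCentralSeries k) (n : ℤ) :
    f (g ^ n) = n • f g := by
  have hn : ∀ n : ℕ, f (g ^ n) = n • f g := by
    intro n
    induction n with
    | zero => simp [hf.map_one]
    | succ n ih => rw [pow_succ, hf.map_mul _ (pow_mem hg n) _ hg, ih, succ_nsmul]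
  cases n with
  | ofNat n => simpa using hn n
  | negSucc n => rw [zpow_negSucc, hf.map_inv (pow_mem hg _), hn, negSucc_zsmul]

/-- If a class modulo `γ_{k+2}(F)` is a sum of classes of elements of `H ≥ γ_{k+2}(F)`, then its
representatives lie in `H`. -/
lemma mem_of_lcsClass_mem_closure {k : ℕ} {H : Subgroup F}
    (hH : (⊤ : Subgroup F).lowerCentralSeries (k + 1) ≤ H) {g : F}
    (hg : g ∈ (⊤ : Subgroup F).lowerCentralSeries k)
    (h : lcsClass k g ∈ AddSubgroup.closure
      (lcsClass k '' {a | a ∈ H ∧ a ∈ (⊤ : Subgroup F).lowerCentralSeries k})) : g ∈ H := by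
  have key : ∀ c ∈ AddSubgroup.closure
      (lcsClass k '' {a | a ∈ H ∧ a ∈ (⊤ : Subgroup F).lowerCentralSeries k}),
      ∃ a, (a ∈ H ∧ a ∈ (⊤ : Subgroup F).lowerCentralSeries k) ∧ lcsClass k a = c := by
    intro c hc
    induction hc using AddSubgroup.closure_induction with
    | mem c hc => exact hc
    | zero => exact ⟨1, ⟨one_mem _, one_mem _⟩, (isGraded_lcsClass k).map_one⟩
    | add c d _ _ hc hd =>
      obtain ⟨a, ⟨ha, ha'⟩, rfl⟩ := hc
      obtain ⟨b, ⟨hb, hb'⟩, rfl⟩ := hd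
      exact ⟨a * b, ⟨mul_mem ha hb, mul_mem ha' hb'⟩, (isGraded_lcsClass k).map_mul a ha' b hb'⟩
    | neg c _ hc =>
      obtain ⟨a, ⟨ha, ha'⟩, rfl⟩ := hc
      exact ⟨a⁻¹, ⟨inv_mem ha, inv_mem ha'⟩, (isGraded_lcsClass k).map_inv ha'⟩
  obtain ⟨a, ⟨ha, ha'⟩, hag⟩ := key _ h
  have h1 : lcsClass k (g * a⁻¹) = 0 := by
    rw [(isGraded_lcsClass k).map_mul g hg _ (inv_mem ha'), (isGraded_lcsClass k).map_inv ha', hag,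
      add_neg_cancel]
  have h2 := hH ((lcsClass_eq_zero (mul_mem hg (inv_mem ha'))).1 h1)
  simpa using mul_mem h2 ha

end GroupTheory

/-! ### Commutators and powers modulo powers of the augmentation ideal -/

section GroupRing

variable {G : Type*} [Group G]

lemma of_sub_one_mem_augIdeal (g : G) : MonoidAlgebra.of ℤ G g - 1 ∈ augIdeal G := by
  rw [augIdeal, RingHom.mem_ker]
  simp [augmentation]

lemma of_mul_sub_one (g h : G) :
    MonoidAlgebra.of ℤ G (g * h) - 1 = (MonoidAlgebra.of ℤ G g - 1) +
      (MonoidAlgebra.of ℤ G h - 1) +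
      (MonoidAlgebra.of ℤ G g - 1) * (MonoidAlgebra.of ℤ G h - 1) := by
  rw [map_mul]; noncomm_ring

lemma mul_mem_augIdeal_pow {a b : ℕ} {u v : MonoidAlgebra ℤ G} (hu : u ∈ augIdeal G ^ a)
    (hv : v ∈ augIdeal G ^ b) : u * v ∈ augIdeal G ^ (a + b) := by
  rw [Ideal.IsTwoSided.pow_add]
  exact Ideal.mul_mem_mul hu hv

/-- Since ⁅g, h⁆ - 1 = (gh - hg)g⁻¹h⁻¹ and gh - hg is the ring commutator of g - 1 and h - 1, the
error is that ring commutator times g⁻¹h⁻¹ - 1, which gains one degree. -/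
lemma of_commutator_sub_one_sub_mem {a b : ℕ} {g h : G}
    (hg : MonoidAlgebra.of ℤ G g - 1 ∈ augIdeal G ^ a)
    (hh : MonoidAlgebra.of ℤ G h - 1 ∈ augIdeal G ^ b) :
    MonoidAlgebra.of ℤ G ⁅g, h⁆ - 1 -
      ((MonoidAlgebra.of ℤ G g - 1) * (MonoidAlgebra.of ℤ G h - 1) -
        (MonoidAlgebra.of ℤ G h - 1) * (MonoidAlgebra.of ℤ G g - 1)) ∈
      augIdeal G ^ (a + b + 1) := by
  have e : MonoidAlgebra.of ℤ G ⁅g, h⁆ - 1 -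
      ((MonoidAlgebra.of ℤ G g - 1) * (MonoidAlgebra.of ℤ G h - 1) -
        (MonoidAlgebra.of ℤ G h - 1) * (MonoidAlgebra.of ℤ G g - 1)) =
      ((MonoidAlgebra.of ℤ G g - 1) * (MonoidAlgebra.of ℤ G h - 1) -
        (MonoidAlgebra.of ℤ G h - 1) * (MonoidAlgebra.of ℤ G g - 1)) *
      (MonoidAlgebra.of ℤ G (g⁻¹ * h⁻¹) - 1) := by
    have h1 : (MonoidAlgebra.of ℤ G g - 1) * (MonoidAlgebra.of ℤ G h - 1) -
        (MonoidAlgebra.of ℤ G h - 1) * (MonoidAlgebra.of ℤ G g - 1) =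
        MonoidAlgebra.of ℤ G (g * h) - MonoidAlgebra.of ℤ G (h * g) := by
      rw [map_mul, map_mul]; noncomm_ring
    rw [h1, mul_sub, sub_mul, ← map_mul, ← map_mul, commutatorElement_def]
    have h2 : h * g * (g⁻¹ * h⁻¹) = 1 := by group
    rw [h2, map_one, mul_one, ← mul_assoc]
  rw [e]
  refine mul_mem_augIdeal_pow (sub_mem (mul_mem_augIdeal_pow hg hh) ?_)
    (by rw [Submodule.pow_one]; exact of_sub_one_mem_augIdeal _)
  rw [add_comm]
  exact mul_mem_augIdeal_pow hh hg

lemma of_commutator_sub_one_mem {a b : ℕ} {g h : G}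
    (hg : MonoidAlgebra.of ℤ G g - 1 ∈ augIdeal G ^ a)
    (hh : MonoidAlgebra.of ℤ G h - 1 ∈ augIdeal G ^ b) :
    MonoidAlgebra.of ℤ G ⁅g, h⁆ - 1 ∈ augIdeal G ^ (a + b) := by
  have h1 := Ideal.pow_le_pow_right (a + b).le_succ (of_commutator_sub_one_sub_mem hg hh)
  have h2 : (MonoidAlgebra.of ℤ G h - 1) * (MonoidAlgebra.of ℤ G g - 1) ∈
      augIdeal G ^ (a + b) := by
    rw [add_comm]; exact mul_mem_augIdeal_pow hh hg
  simpa using add_mem h1 (sub_mem (mul_mem_augIdeal_pow hg hh) h2)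

lemma of_sub_one_mem_of_mem_lcs {k : ℕ} {g : G}
    (hg : g ∈ (⊤ : Subgroup G).lowerCentralSeries k) :
    MonoidAlgebra.of ℤ G g - 1 ∈ augIdeal G ^ (k + 1) := by
  induction k generalizing g with
  | zero => rw [zero_add, Submodule.pow_one]; exact of_sub_one_mem_augIdeal g
  | succ k ih =>
    -- With the zero ideal, `D` is the ordinary dimension subgroup; being a subgroup, it need only
    -- contain the generating commutators.
    have h : (⊤ : Subgroup G).lowerCentralSeries (k + 1) ≤ D (k + 1 + 1) ⊥ := by
      refine Subgroup.commutator_le.2 fun p hp q _ => ?_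
      change MonoidAlgebra.of ℤ G ⁅p, q⁆ - 1 ∈ ⊥ ⊔ augIdeal G ^ (k + 1 + 1)
      rw [bot_sup_eq]
      refine of_commutator_sub_one_mem (ih hp) ?_
      rw [Submodule.pow_one]
      exact of_sub_one_mem_augIdeal q
    have hg' : MonoidAlgebra.of ℤ G g - 1 ∈ ⊥ ⊔ augIdeal G ^ (k + 1 + 1) := h hg
    rwa [bot_sup_eq] at hg'

lemma of_zpow_sub_one_sub_mem {k : ℕ} {g : G}
    (hg : MonoidAlgebra.of ℤ G g - 1 ∈ augIdeal G ^ k) (n : ℤ) :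
    MonoidAlgebra.of ℤ G (g ^ n) - 1 - n • (MonoidAlgebra.of ℤ G g - 1) ∈
      augIdeal G ^ (k + 1) := by
  have hmem : ∀ n : ℤ, MonoidAlgebra.of ℤ G (g ^ n) - 1 ∈ augIdeal G ^ 1 := by
    intro n; rw [Submodule.pow_one]; exact of_sub_one_mem_augIdeal _
  have step : ∀ n : ℤ, (MonoidAlgebra.of ℤ G (g ^ (n + 1)) - 1 -
      (n + 1) • (MonoidAlgebra.of ℤ G g - 1)) - (MonoidAlgebra.of ℤ G (g ^ n) - 1 -
      n • (MonoidAlgebra.of ℤ G g - 1)) ∈ augIdeal G ^ (k + 1) := by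
    intro n
    have e : (MonoidAlgebra.of ℤ G (g ^ (n + 1)) - 1 -
      (n + 1) • (MonoidAlgebra.of ℤ G g - 1)) - (MonoidAlgebra.of ℤ G (g ^ n) - 1 -
      n • (MonoidAlgebra.of ℤ G g - 1)) =
      (MonoidAlgebra.of ℤ G (g ^ n) - 1) * (MonoidAlgebra.of ℤ G g - 1) := by
      rw [zpow_add_one, of_mul_sub_one, add_smul, one_smul]; abel
    rw [e, add_comm]
    exact mul_mem_augIdeal_pow (hmem n) hg
  induction n using Int.induction_on with
  | zero => rw [zpow_zero, map_one, sub_self, zero_smul, sub_self]; exact zero_mem _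
  | succ n ih => simpa using add_mem (step n) ih
  | pred n ih =>
    have h := sub_mem ih (step (-n - 1))
    rw [sub_add_cancel] at h
    simpa using h

end GroupRing

/-! ### Magnus coefficients through unitriangular matrices -/

section Magnus

/-- The matrix `M` vanishes below its `k`-th superdiagonal. -/
def IsUpper (k : ℕ) (M : Matrix (Fin 4) (Fin 4) ℤ) : Prop :=
  ∀ i j : Fin 4, (j : ℕ) < i + k → M i j = 0

namespace IsUpper

variable {k l : ℕ} {M N : Matrix (Fin 4) (Fin 4) ℤ}

lemma mul (hM : IsUpper k M) (hN : IsUpper l N) : IsUpper (k + l) (M * N) := by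
  intro i j hij
  rw [Matrix.mul_apply]
  refine Finset.sum_eq_zero fun t _ => ?_
  by_cases h : (t : ℕ) < i + k
  · rw [hM i t h, zero_mul]
  · rw [hN t j (by omega), mul_zero]

lemma add (hM : IsUpper k M) (hN : IsUpper k N) : IsUpper k (M + N) := fun i j h => by
  rw [Matrix.add_apply, hM i j h, hN i j h, add_zero]

lemma smul (hM : IsUpper k M) (n : ℤ) : IsUpper k (n • M) := fun i j h => by
  rw [Matrix.smul_apply, hM i j h, smul_zero]

lemma mono (hM : IsUpper k M) (h : l ≤ k) : IsUpper l M := fun i j hij => hM i j (by omega)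

lemma zero : IsUpper k (0 : Matrix (Fin 4) (Fin 4) ℤ) := fun _ _ _ => rfl

lemma one : IsUpper 0 (1 : Matrix (Fin 4) (Fin 4) ℤ) := fun i j h =>
  Matrix.one_apply_ne fun e => by subst e; omega

end IsUpper

/-- The unitriangular matrix with superdiagonal `(a, b, c)` and no other entries. -/
def bidiagonalUnit (a b c : ℤ) : (Matrix (Fin 4) (Fin 4) ℤ)ˣ where
  val := !![1, a, 0, 0; 0, 1, b, 0; 0, 0, 1, c; 0, 0, 0, 1]
  -- This is 1 - N + N² - N³, where N is the superdiagonal part.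
  inv := !![1, -a, a * b, -(a * b * c); 0, 1, -b, b * c; 0, 0, 1, -c; 0, 0, 0, 1]
  val_inv := by
    ext i j
    fin_cases i <;> fin_cases j <;> simp [Matrix.mul_apply, Fin.sum_univ_four]
    ring
  inv_val := by
    ext i j
    fin_cases i <;> fin_cases j <;> simp [Matrix.mul_apply, Fin.sum_univ_four]

lemma isUpper_bidiagonalUnit (a b c : ℤ) :
    IsUpper 1 ((bidiagonalUnit a b c : Matrix (Fin 4) (Fin 4) ℤ) - 1) := by
  intro i j h
  fin_cases i <;> fin_cases j <;> simp [bidiagonalUnit] at h ⊢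

lemma isUpper_bidiagonalUnit_inv (a b c : ℤ) :
    IsUpper 1 (((bidiagonalUnit a b c)⁻¹ : (Matrix (Fin 4) (Fin 4) ℤ)ˣ).val - 1) := by
  change IsUpper 1 ((bidiagonalUnit a b c).inv - 1)
  intro i j h
  fin_cases i <;> fin_cases j <;> simp [bidiagonalUnit] at h ⊢

variable {ι F : Type*} [DecidableEq ι] [Group F] (x : FreeGroupBasis ι F) (w : Fin 3 → ι)

lemma closure_range_freeGroupBasis {ι F : Type*} [Group F] (x : FreeGroupBasis ι F) :
    Subgroup.closure (Set.range x) = ⊤ := by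
  have h : Set.range x = x.repr.symm.toMonoidHom '' Set.range (FreeGroup.of : ι → _) := by
    rw [← Set.range_comp]; rfl
  rw [h, ← MonoidHom.map_closure, FreeGroup.closure_range_of, ← MonoidHom.range_eq_map,
    MonoidHom.range_eq_top]
  exact x.repr.symm.surjective

/-- The representation of `ℤ[F]` by `4 × 4` upper triangular matrices whose `(0, k)` entry is the
coefficient of the length `k` prefix of the word `w` in the Magnus expansion. -/
noncomputable def magnusRep : MonoidAlgebra ℤ F →ₐ[ℤ] Matrix (Fin 4) (Fin 4) ℤ :=
  MonoidAlgebra.lift ℤ _ F ((Units.coeHom _).comp (x.lift fun p =>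
    bidiagonalUnit (if w 0 = p then 1 else 0) (if w 1 = p then 1 else 0)
      (if w 2 = p then 1 else 0)))

lemma magnusRep_of (g : F) :
    magnusRep x w (MonoidAlgebra.of ℤ F g) = (x.lift (fun p =>
      bidiagonalUnit (if w 0 = p then 1 else 0) (if w 1 = p then 1 else 0)
        (if w 2 = p then 1 else 0)) g).val := by
  rw [magnusRep, MonoidAlgebra.lift_of]
  rfl

lemma freeGroupBasis_lift_apply {ι F H : Type*} [Group F] [Group H] (x : FreeGroupBasis ι F)
    (f : ι → H) (p : ι) : x.lift f (x p) = f p :=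
  congrFun (x.lift.symm_apply_apply f) p

/-- The matrix with superdiagonal `(a, b, c)` and no other entries. -/
def bidiagonal (a b c : ℤ) : Matrix (Fin 4) (Fin 4) ℤ :=
  !![0, a, 0, 0; 0, 0, b, 0; 0, 0, 0, c; 0, 0, 0, 0]

lemma bidiagonal_mul_apply (a b c a' b' c' : ℤ) :
    (bidiagonal a b c * bidiagonal a' b' c') 0 2 = a * b' := by
  simp [bidiagonal, Matrix.mul_apply, Fin.sum_univ_four]

lemma bidiagonal_mul_mul_apply (a b c a' b' c' a'' b'' c'' : ℤ) :
    (bidiagonal a b c * bidiagonal a' b' c' * bidiagonal a'' b'' c'') 0 3 = a * b' * c'' := by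
  simp [bidiagonal, Matrix.mul_apply, Fin.sum_univ_four]

lemma magnusRep_basis_sub_one (p : ι) :
    magnusRep x w (MonoidAlgebra.of ℤ F (x p) - 1) =
      bidiagonal (if w 0 = p then 1 else 0) (if w 1 = p then 1 else 0)
        (if w 2 = p then 1 else 0) := by
  rw [map_sub, map_one, magnusRep_of, freeGroupBasis_lift_apply]
  ext i j
  fin_cases i <;> fin_cases j <;> simp [bidiagonalUnit, bidiagonal]

lemma isUpper_magnusRep_of_sub_one (g : F) :
    IsUpper 1 (magnusRep x w (MonoidAlgebra.of ℤ F g - 1)) := by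
  have hg : g ∈ Subgroup.closure (Set.range x) :=
    closure_range_freeGroupBasis x ▸ Subgroup.mem_top g
  induction hg using Subgroup.closure_induction'' with
  | mem a ha =>
    obtain ⟨p, rfl⟩ := ha
    rw [map_sub, map_one, magnusRep_of, freeGroupBasis_lift_apply]
    exact isUpper_bidiagonalUnit _ _ _
  | inv_mem a ha =>
    obtain ⟨p, rfl⟩ := ha
    rw [map_sub, map_one, magnusRep_of, map_inv, freeGroupBasis_lift_apply]
    exact isUpper_bidiagonalUnit_inv _ _ _
  | one => rw [map_one, sub_self, map_zero]; exact IsUpper.zero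
  | mul a b _ _ ha hb =>
    rw [of_mul_sub_one, map_add, map_add, map_mul]
    exact (ha.add hb).add ((ha.mul hb).mono (by norm_num))

lemma isUpper_magnusRep_sub_augmentation (y : MonoidAlgebra ℤ F) :
    IsUpper 1 (magnusRep x w (y - algebraMap ℤ _ (augmentation F y))) := by
  induction y using MonoidAlgebra.induction_on with
  | of g =>
    have e : augmentation F (MonoidAlgebra.of ℤ F g) = 1 := by simp [augmentation]
    rw [e, map_one]
    exact isUpper_magnusRep_of_sub_one x w g
  | add a b ha hb =>
    rw [map_add, map_add, add_sub_add_comm, map_add]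
    exact ha.add hb
  | smul r a ha =>
    have e : r • a - algebraMap ℤ (MonoidAlgebra ℤ F) (augmentation F (r • a)) =
        r • (a - algebraMap ℤ _ (augmentation F a)) := by
      rw [map_smul, smul_sub, smul_eq_mul, map_mul, ← Algebra.smul_def]
    rw [e, map_smul]
    exact ha.smul r

lemma isUpper_magnusRep (y : MonoidAlgebra ℤ F) : IsUpper 0 (magnusRep x w y) := by
  have h := ((isUpper_magnusRep_sub_augmentation x w y).mono zero_le_one).add
    (IsUpper.one.smul (augmentation F y))
  rwa [map_sub, AlgHom.commutes, Algebra.algebraMap_eq_smul_one, sub_add_cancel] at h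

lemma isUpper_magnusRep_of_mem_pow {k : ℕ} {y : MonoidAlgebra ℤ F} (hy : y ∈ augIdeal F ^ k) :
    IsUpper k (magnusRep x w y) := by
  have h1 : ∀ y ∈ augIdeal F, IsUpper 1 (magnusRep x w y) := by
    intro y hy
    have h := isUpper_magnusRep_sub_augmentation x w y
    rwa [show augmentation F y = 0 from hy, map_zero, sub_zero] at h
  induction k generalizing y with
  | zero => exact isUpper_magnusRep x w y
  | succ k ih =>
    rw [Submodule.pow_succ, ← Ideal.smul_eq_mul] at hy
    induction hy using Submodule.smul_induction_on' with
    | smul a ha b hb => rw [smul_eq_mul, map_mul]; exact (ih ha).mul (h1 b hb)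
    | add a _ b _ ha hb => rw [map_add]; exact ha.add hb

/-- The entry `(i, j)` of the Magnus representation of `g - 1`. -/
noncomputable def magnusEntry (i j : Fin 4) (g : F) : ℤ :=
  magnusRep x w (MonoidAlgebra.of ℤ F g - 1) i j

lemma isGraded_magnusEntry {k : ℕ} {i j : Fin 4} (hij : (j : ℕ) = i + k + 1) :
    IsGraded k (magnusEntry x w i j) where
  map_mul g hg h hh := by
    have hu := isUpper_magnusRep_of_mem_pow x w
      (mul_mem_augIdeal_pow (of_sub_one_mem_of_mem_lcs hg) (of_sub_one_mem_of_mem_lcs hh))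
    rw [magnusEntry, of_mul_sub_one, map_add, map_add, Matrix.add_apply, Matrix.add_apply,
      hu i j (by omega), add_zero]
    rfl
  map_succ g hg := isUpper_magnusRep_of_mem_pow x w (of_sub_one_mem_of_mem_lcs hg) i j (by omega)

lemma magnusEntry_basis (p : ι) :
    magnusEntry x w 0 1 (x p) = if w 0 = p then 1 else 0 := by
  rw [magnusEntry, magnusRep_basis_sub_one]; rfl

lemma magnusEntry_basis' (p : ι) :
    magnusEntry x w 1 2 (x p) = if w 1 = p then 1 else 0 := by
  rw [magnusEntry, magnusRep_basis_sub_one]; rfl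

lemma magnusRep_apply_eq_of_sub_mem {k : ℕ} {y z : MonoidAlgebra ℤ F}
    (h : y - z ∈ augIdeal F ^ k) {i j : Fin 4} (hij : (j : ℕ) < i + k) :
    magnusRep x w y i j = magnusRep x w z i j := by
  have hu := isUpper_magnusRep_of_mem_pow x w h i j hij
  rwa [map_sub, Matrix.sub_apply, sub_eq_zero] at hu

lemma magnusEntry_commutator (p q : ι) :
    magnusEntry x w 0 2 ⁅x p, x q⁆ =
      (if w 0 = p ∧ w 1 = q then 1 else 0) - (if w 0 = q ∧ w 1 = p then 1 else 0) := by
  have h := of_commutator_sub_one_sub_mem (a := 1) (b := 1) (g := x p) (h := x q)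
    (by rw [Submodule.pow_one]; exact of_sub_one_mem_augIdeal _)
    (by rw [Submodule.pow_one]; exact of_sub_one_mem_augIdeal _)
  rw [magnusEntry, magnusRep_apply_eq_of_sub_mem x w h (by simp), map_sub, map_mul, map_mul,
    magnusRep_basis_sub_one, magnusRep_basis_sub_one, Matrix.sub_apply, bidiagonal_mul_apply,
    bidiagonal_mul_apply]
  simp only [ite_zero_mul_ite_zero, mul_one]

lemma of_triple_commutator_sub_one_sub_mem (a b c : F) :
    MonoidAlgebra.of ℤ F ⁅⁅a, b⁆, c⁆ - 1 -
      (((MonoidAlgebra.of ℤ F a - 1) * (MonoidAlgebra.of ℤ F b - 1) -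
          (MonoidAlgebra.of ℤ F b - 1) * (MonoidAlgebra.of ℤ F a - 1)) *
          (MonoidAlgebra.of ℤ F c - 1) -
        (MonoidAlgebra.of ℤ F c - 1) *
          ((MonoidAlgebra.of ℤ F a - 1) * (MonoidAlgebra.of ℤ F b - 1) -
          (MonoidAlgebra.of ℤ F b - 1) * (MonoidAlgebra.of ℤ F a - 1))) ∈ augIdeal F ^ 4 := by
  have hm : ∀ a : F, MonoidAlgebra.of ℤ F a - 1 ∈ augIdeal F ^ 1 := fun a => by
    rw [Submodule.pow_one]; exact of_sub_one_mem_augIdeal _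
  have h1 := of_commutator_sub_one_sub_mem (hm a) (hm b)
  have h2 := of_commutator_sub_one_sub_mem (of_commutator_sub_one_mem (hm a) (hm b)) (hm c)
  have h3 : _ ∈ augIdeal F ^ 4 :=
    sub_mem (mul_mem_augIdeal_pow h1 (hm c)) (mul_mem_augIdeal_pow (a := 1) (b := 3) (hm c) h1)
  convert add_mem h2 h3 using 1
  noncomm_ring

lemma magnusEntry_triple_commutator (p q r : ι) :
    magnusEntry x w 0 3 ⁅⁅x p, x q⁆, x r⁆ =
      (if w 0 = p ∧ w 1 = q ∧ w 2 = r then 1 else 0) -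
      (if w 0 = q ∧ w 1 = p ∧ w 2 = r then 1 else 0) -
      (if w 0 = r ∧ w 1 = p ∧ w 2 = q then 1 else 0) +
      (if w 0 = r ∧ w 1 = q ∧ w 2 = p then 1 else 0) := by
  rw [magnusEntry, magnusRep_apply_eq_of_sub_mem x w
    (of_triple_commutator_sub_one_sub_mem (x p) (x q) (x r)) (by simp)]
  rw [map_sub (magnusRep x w), map_mul, map_mul, map_sub (magnusRep x w) (_ * _), map_mul,
    map_mul]
  simp only [magnusRep_basis_sub_one, sub_mul, mul_sub, ← mul_assoc, Matrix.sub_apply,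
    bidiagonal_mul_mul_apply]
  simp only [ite_zero_mul_ite_zero, mul_one, and_assoc]
  ring

lemma magnusEntry_triple_commutator_vec (a b c p q r : ι) :
    magnusEntry x ![a, b, c] 0 3 ⁅⁅x p, x q⁆, x r⁆ =
      (if a = p ∧ b = q ∧ c = r then 1 else 0) - (if a = q ∧ b = p ∧ c = r then 1 else 0) -
      (if a = r ∧ b = p ∧ c = q then 1 else 0) + (if a = r ∧ b = q ∧ c = p then 1 else 0) :=
  magnusEntry_triple_commutator x ![a, b, c] p q r

end Magnus

/-! ### Coordinates on γ_3/γ_4, and membership in 𝔣𝔯𝔣 + 𝔣⁴ -/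

section Main

variable {m : ℕ} {F : Type*} [Group F] (x : FreeGroupBasis (Fin m) F)

lemma basis_commutator_mem (p q : Fin m) :
    ⁅x p, x q⁆ ∈ (⊤ : Subgroup F).lowerCentralSeries 1 :=
  commutator_mem_lcs_succ (k := 0) (Subgroup.mem_top _) _

lemma basis_triple_commutator_mem (p q r : Fin m) :
    ⁅⁅x p, x q⁆, x r⁆ ∈ (⊤ : Subgroup F).lowerCentralSeries 2 :=
  commutator_mem_lcs_succ (basis_commutator_mem x p q) _

namespace IsGraded

variable {A : Type*} [AddCommGroup A] {f : F → A}

lemma eq_zero_of_basis_commutator (hf : IsGraded 1 f) (h : ∀ p q, f ⁅x p, x q⁆ = 0) {g : F}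
    (hg : g ∈ (⊤ : Subgroup F).lowerCentralSeries 1) : f g = 0 := by
  refine hf.eq_zero_of_commutator (closure_range_freeGroupBasis x) ?_ hg
  rintro _ ⟨q, rfl⟩ g -
  refine (hf.commutator_left (x q)).eq_zero_of_zero (closure_range_freeGroupBasis x) ?_ g
  rintro _ ⟨p, rfl⟩
  exact h p q

lemma eq_zero_of_basis_triple_commutator (hf : IsGraded 2 f)
    (h : ∀ p q r, f ⁅⁅x p, x q⁆, x r⁆ = 0) {g : F}
    (hg : g ∈ (⊤ : Subgroup F).lowerCentralSeries 2) : f g = 0 := by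
  refine hf.eq_zero_of_commutator (closure_range_freeGroupBasis x) ?_ hg
  rintro _ ⟨r, rfl⟩ g hg
  exact (hf.commutator_left (x r)).eq_zero_of_basis_commutator x (fun p q => h p q r) hg

/-- Used with `f` the class map and the `c i` Magnus coefficients: an expansion formula need then
only be checked on commutators of basis elements. -/
lemma sub_sum_zsmul {ι : Type*} [Fintype ι] {k : ℕ} {c : ι → F → ℤ} (a : ι → A)
    (hf : IsGraded k f) (hc : ∀ i, IsGraded k (c i)) :
    IsGraded k fun g => f g - ∑ i, c i g • a i where
  map_mul g hg h hh := by
    simp only [hf.map_mul g hg h hh, fun i => (hc i).map_mul g hg h hh, add_smul,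
      Finset.sum_add_distrib]
    abel
  map_succ g hg := by
    simp only [hf.map_succ g hg, fun i => (hc i).map_succ g hg, zero_smul, Finset.sum_const_zero,
      sub_zero]

end IsGraded

lemma isGraded_add {A : Type*} [AddCommGroup A] {k : ℕ} {f f' : F → A}
    (hf : IsGraded k f) (hf' : IsGraded k f') : IsGraded k fun g => f g + f' g where
  map_mul g hg h hh := by rw [hf.map_mul g hg h hh, hf'.map_mul g hg h hh]; abel
  map_succ g hg := by rw [hf.map_succ g hg, hf'.map_succ g hg, add_zero]

lemma mem_lcs_one_of_magnusEntry {g : F}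
    (h : ∀ w : Fin 3 → Fin m, magnusEntry x w 0 1 g = 0) :
    g ∈ (⊤ : Subgroup F).lowerCentralSeries 1 := by
  rw [← lcsClass_eq_zero (k := 0) (Subgroup.mem_top g)]
  have hf := IsGraded.sub_sum_zsmul (fun i => lcsClass 0 (x i)) (isGraded_lcsClass (F := F) 0)
    fun i => isGraded_magnusEntry x (fun _ => i) (k := 0) (i := 0) (j := 1) rfl
  have h0 := hf.eq_zero_of_zero (closure_range_freeGroupBasis x) (by
    rintro _ ⟨p, rfl⟩
    simp [magnusEntry_basis]) g
  simpa [h] using h0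

lemma mem_lcs_two_of_magnusEntry {g : F} (hg : g ∈ (⊤ : Subgroup F).lowerCentralSeries 1)
    (h : ∀ w : Fin 3 → Fin m, magnusEntry x w 0 2 g = 0) :
    g ∈ (⊤ : Subgroup F).lowerCentralSeries 2 := by
  rw [← lcsClass_eq_zero hg]
  -- Only increasing words are read, so each pair of basis elements counts once. The third letter is
  -- filler: entry (0, 2) involves only the first two.
  have hf := IsGraded.sub_sum_zsmul
    (fun i : Fin m × Fin m => if i.1 < i.2 then lcsClass 1 ⁅x i.1, x i.2⁆ else 0)
    (isGraded_lcsClass (F := F) 1)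
    fun i => isGraded_magnusEntry x ![i.1, i.2, i.2] (k := 1) (i := 0) (j := 2) rfl
  have h0 := hf.eq_zero_of_basis_commutator x (by
    intro p q
    have hs : ∀ p q : Fin m, ∑ i : Fin m × Fin m, (if i.1 = p ∧ i.2 = q then (1 : ℤ) else 0) •
        (if i.1 < i.2 then lcsClass 1 ⁅x i.1, x i.2⁆ else 0) =
        if p < q then lcsClass 1 ⁅x p, x q⁆ else 0 := by
      intro p q
      rw [Finset.sum_eq_single (p, q)]
      · simp
      · rintro ⟨a, b⟩ - hne
        rw [if_neg (fun hab => hne (Prod.ext hab.1 hab.2)), zero_smul]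
      · simp
    have hval : ∀ i : Fin m × Fin m, magnusEntry x ![i.1, i.2, i.2] 0 2 ⁅x p, x q⁆ =
        (if i.1 = p ∧ i.2 = q then 1 else 0) - (if i.1 = q ∧ i.2 = p then 1 else 0) :=
      fun i => magnusEntry_commutator x ![i.1, i.2, i.2] p q
    simp only [hval, sub_smul, Finset.sum_sub_distrib, hs]
    rcases lt_trichotomy p q with hpq | rfl | hpq
    · simp [hpq, hpq.not_gt]
    · simp [(isGraded_lcsClass (F := F) 1).map_one]
    · have := (isGraded_lcsClass (F := F) 1).map_inv (basis_commutator_mem x q p)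
      rw [commutatorElement_inv] at this
      simp [hpq, hpq.not_gt, this]) hg
  simpa [h] using h0

/-- The coefficient of the word `(i.1, i.2.1, i.2.2)` in the expression of a class modulo
`γ_4(F)` through its Magnus coefficients. -/
noncomputable def tripleClass (i : Fin m × Fin m × Fin m) : Additive (LcsQuotient F 2) :=
  (if i.2.1 = i.2.2 then lcsClass 2 ⁅⁅x i.1, x i.2.1⁆, x i.2.2⁆ else 0) +
  (if i.1 < i.2.2 ∧ i.2.1 < i.2.2 ∧ i.1 ≠ i.2.1 then lcsClass 2 ⁅⁅x i.2.2, x i.2.1⁆, x i.1⁆ else 0)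

/-- The four terms are the signed words in the expansion of [[x_p,x_q],x_r], so this is the
expansion formula on that commutator. Jacobi is needed only when p ≠ q and r exceeds both; otherwise
antisymmetry suffices. -/
lemma tripleClass_alternating_sum (p q r : Fin m) :
    tripleClass x (p, q, r) - tripleClass x (q, p, r) - tripleClass x (r, p, q) +
      tripleClass x (r, q, p) = lcsClass 2 ⁅⁅x p, x q⁆, x r⁆ := by
  have hf := isGraded_lcsClass (F := F) 2
  have hsw := fun a b c => hf.map_commutator_swap (x a) (x b) (x c)
  have hJ := hf.map_commutator_jacobi (x p) (x q) (x r)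
  have hz : ∀ a b, lcsClass 2 ⁅⁅x a, x a⁆, x b⁆ = 0 := fun a b => by
    rw [commutatorElement_self, commutatorElement_one_left, hf.map_one]
  unfold tripleClass
  generalize hT : (fun a b c => lcsClass 2 ⁅⁅x a, x b⁆, x c⁆) = T at *
  have hT' : ∀ a b c, lcsClass 2 ⁅⁅x a, x b⁆, x c⁆ = T a b c := fun a b c => by rw [← hT]
  simp only [hT'] at hsw hJ hz ⊢
  clear hT hT'
  have hpqr : T p q r = -T q r p - T r p q := by
    rw [sub_eq_add_neg, ← neg_add, eq_neg_iff_add_eq_zero, ← add_assoc, hJ]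
  rcases eq_or_ne p q with rfl | hpq
  · simp [hz]
  have s1 := hsw q p r
  have s2 := hsw r q p
  rcases lt_trichotomy p r with h1 | h1 | h1 <;> rcases lt_trichotomy q r with h2 | h2 | h2
  · simp [h1, h2, h1.ne, h2.ne, h1.not_gt, h2.not_gt, hpq, hpq.symm, s2, hpqr]
  · subst h2
    simp [h1.ne, h1.not_gt, hpq.symm]
  · simp [h1, h1.ne', h1.not_gt, h2.not_gt, h1.ne, h2.ne', hpq, hpq.symm, h1.trans h2, h2, s1]
  · subst h1
    simp [h2.not_gt, hpq, hpq.symm, s1]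
  · exact absurd (h1.trans h2.symm) hpq
  · subst h1
    simp [h2.not_gt, hpq, hpq.symm, s1]
  · simp [h1, h1.not_gt, h2.not_gt, hpq, hpq.symm, h1.ne', h2.ne', h2, h2.ne, h2.trans h1]
  · subst h2
    simp [h1.not_gt, hpq, hpq.symm]
  · rcases hpq.lt_or_gt with h3 | h3
    · simp [h1, h2, h1.not_gt, h2.not_gt, h1.ne, h1.ne', h2.ne', hpq, hpq.symm, h3, h3.not_gt, s1]
    · simp [h1, h2, h1.not_gt, h2.not_gt, h1.ne', h2.ne', h2.ne, hpq, hpq.symm, h3, h3.not_gt]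

lemma lcsClass_eq_sum {g : F} (hg : g ∈ (⊤ : Subgroup F).lowerCentralSeries 2) :
    lcsClass 2 g = ∑ i : Fin m × Fin m × Fin m,
      magnusEntry x ![i.1, i.2.1, i.2.2] 0 3 g • tripleClass x i := by
  have hf := IsGraded.sub_sum_zsmul (tripleClass x) (isGraded_lcsClass (F := F) 2)
    fun i => isGraded_magnusEntry x ![i.1, i.2.1, i.2.2] (k := 2) (i := 0) (j := 3) rfl
  refine sub_eq_zero.1 (hf.eq_zero_of_basis_triple_commutator x (fun p q r => ?_) hg)
  have hs : ∀ p q r : Fin m, ∑ i : Fin m × Fin m × Fin m,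
      (if i.1 = p ∧ i.2.1 = q ∧ i.2.2 = r then (1 : ℤ) else 0) • tripleClass x i =
      tripleClass x (p, q, r) := by
    intro p q r
    rw [Finset.sum_eq_single (p, q, r)]
    · simp
    · rintro ⟨a, b, c⟩ - hne
      rw [if_neg (fun h => hne (Prod.ext h.1 (Prod.ext h.2.1 h.2.2))), zero_smul]
    · simp
  simp only [magnusEntry_triple_commutator_vec, add_smul, sub_smul, Finset.sum_sub_distrib,
    Finset.sum_add_distrib, hs, tripleClass_alternating_sum, sub_self]

/-- The model case is [[a,b],b] = abb - 2bab + bba; by additivity the relation need only be checked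
on triple commutators of basis elements. -/
lemma magnusEntry_symm {g : F} (hg : g ∈ (⊤ : Subgroup F).lowerCentralSeries 2) (a b : Fin m) :
    magnusEntry x ![b, a, b] 0 3 g + 2 * magnusEntry x ![a, b, b] 0 3 g = 0 := by
  have h1 := isGraded_magnusEntry x ![b, a, b] (k := 2) (i := 0) (j := 3) rfl
  have h2 := isGraded_magnusEntry x ![a, b, b] (k := 2) (i := 0) (j := 3) rfl
  have h3 := (isGraded_add h1 (isGraded_add h2 h2)).eq_zero_of_basis_triple_commutator x
    (fun p q r => by
      simp only [magnusEntry_triple_commutator_vec, ite_and]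
      split_ifs <;> rfl) hg
  rw [two_mul]
  exact h3

/-- Modulo `𝔣²` the ideal `𝔯` has its coefficient at `x_p` divisible by `e_p`. -/
lemma dvd_magnusRep_of_mem_relIdeal {e : Fin m → ℕ} {R : Subgroup F}
    (hR : R ≤ Subgroup.closure (Set.range (fun i : Fin m => x i ^ e i) ∪ (gamma F 2 : Set F)))
    (w : Fin 3 → Fin m) {y : MonoidAlgebra ℤ F} (hy : y ∈ relIdeal R) :
    IsUpper 1 (magnusRep x w y) ∧ (e (w 1) : ℤ) ∣ magnusRep x w y 1 2 := by
  have hgr := isGraded_magnusEntry x w (k := 0) (i := 1) (j := 2) rfl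
  unfold relIdeal at hy
  induction hy using Submodule.span_induction with
  | mem y hy =>
    obtain ⟨g, hg, rfl⟩ := hy
    refine ⟨isUpper_magnusRep_of_sub_one x w g, ?_⟩
    change _ ∣ magnusEntry x w 1 2 g
    have hg' := hR hg
    clear hg
    induction hg' using Subgroup.closure_induction with
    | mem a ha =>
      rcases ha with ⟨p, rfl⟩ | ha
      · have := hgr.map_zpow (Subgroup.mem_top (x p)) (e p)
        rw [zpow_natCast] at this
        simp only [this, magnusEntry_basis']
        split_ifs with h
        · simp [h]
        · simp
      · rw [hgr.map_succ a ha]; exact dvd_zero _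
    | one => rw [hgr.map_one]; exact dvd_zero _
    | mul a b _ _ ha hb =>
      rw [hgr.map_mul a (Subgroup.mem_top a) b (Subgroup.mem_top b)]
      exact dvd_add ha hb
    | inv a _ ha => rw [hgr.map_inv (Subgroup.mem_top a)]; exact ha.neg_right
  | zero => rw [map_zero]; exact ⟨IsUpper.zero, dvd_zero _⟩
  | add a b _ _ ha hb => rw [map_add]; exact ⟨ha.1.add hb.1, dvd_add ha.2 hb.2⟩
  | smul c a _ ha =>
    -- The span is that of a left ideal, so only left multiples occur; by triangularity the (1, 2)
    -- entry of the product is c₁₁a₁₂.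
    have hc := isUpper_magnusRep x w c
    rw [smul_eq_mul, map_mul]
    refine ⟨by simpa using hc.mul ha.1, ?_⟩
    rw [Matrix.mul_apply, Fin.sum_univ_four, hc 1 0 (by simp), ha.1 2 2 (by simp),
      ha.1 3 2 (by simp)]
    simpa using ha.2.mul_left _

/-- For a, b in 𝔣 and r in 𝔯, all three matrices are strictly upper triangular, so the (0, 3) entry
of arb is a₀₁r₁₂b₂₃; 𝔣⁴ contributes zero. -/
lemma dvd_magnusRep_of_mem {e : Fin m → ℕ} {R : Subgroup F}
    (hR : R ≤ Subgroup.closure (Set.range (fun i : Fin m => x i ^ e i) ∪ (gamma F 2 : Set F)))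
    (w : Fin 3 → Fin m) {y : MonoidAlgebra ℤ F}
    (hy : y ∈ augIdeal F * relIdeal R * augIdeal F ⊔ augIdeal F ^ 4) :
    IsUpper 3 (magnusRep x w y) ∧ (e (w 1) : ℤ) ∣ magnusRep x w y 0 3 := by
  have haug : ∀ a ∈ augIdeal F, IsUpper 1 (magnusRep x w a) := fun a ha =>
    isUpper_magnusRep_of_mem_pow x w (k := 1) (by rwa [Submodule.pow_one])
  obtain ⟨a, ha, b, hb, rfl⟩ := Submodule.mem_sup.1 hy
  have hb' := isUpper_magnusRep_of_mem_pow x w hb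
  suffices h : IsUpper 3 (magnusRep x w a) ∧ (e (w 1) : ℤ) ∣ magnusRep x w a 0 3 by
    rw [map_add]
    refine ⟨h.1.add (hb'.mono (by norm_num)), ?_⟩
    rw [Matrix.add_apply, hb' 0 3 (by simp), add_zero]
    exact h.2
  have h1 : ∀ a ∈ augIdeal F * relIdeal R,
      IsUpper 2 (magnusRep x w a) ∧ (e (w 1) : ℤ) ∣ magnusRep x w a 0 2 := by
    intro a ha
    rw [← Ideal.smul_eq_mul] at ha
    induction ha using Submodule.smul_induction_on' with
    | smul a ha b hb =>
      have ha' := haug a ha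
      have hb' := dvd_magnusRep_of_mem_relIdeal x hR w hb
      rw [smul_eq_mul, map_mul]
      refine ⟨ha'.mul hb'.1, ?_⟩
      rw [Matrix.mul_apply, Fin.sum_univ_four, ha' 0 0 (by simp), hb'.1 2 2 (by simp),
        hb'.1 3 2 (by simp)]
      simpa using hb'.2.mul_left _
    | add a _ b _ ha hb => rw [map_add]; exact ⟨ha.1.add hb.1, dvd_add ha.2 hb.2⟩
  clear hy
  rw [← Ideal.smul_eq_mul] at ha
  induction ha using Submodule.smul_induction_on' with
  | smul a ha b hb =>
    have hb' := haug b hb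
    have ha' := h1 a ha
    rw [smul_eq_mul, map_mul]
    refine ⟨ha'.1.mul hb', ?_⟩
    rw [Matrix.mul_apply, Fin.sum_univ_four, ha'.1 0 0 (by simp), ha'.1 0 1 (by simp),
      hb' 3 3 (by simp)]
    simpa using ha'.2.mul_right _
  | add a _ b _ ha hb => rw [map_add]; exact ⟨ha.1.add hb.1, dvd_add ha.2 hb.2⟩

/-- If `e_q ∣ n` then `n (x_p - 1) (x_q - 1) (x_r - 1)` lies in `𝔣𝔯𝔣 + 𝔣⁴`. -/
lemma zsmul_mul_mul_mem {e : Fin m → ℕ} {R : Subgroup F} [R.Normal]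
    (hR : ∀ i, x i ^ e i ∈ R ⊔ gamma F 2) {n : ℤ} (p q r : Fin m) (hn : (e q : ℤ) ∣ n) :
    n • ((MonoidAlgebra.of ℤ F (x p) - 1) * (MonoidAlgebra.of ℤ F (x q) - 1) *
      (MonoidAlgebra.of ℤ F (x r) - 1)) ∈
      augIdeal F * relIdeal R * augIdeal F ⊔ augIdeal F ^ 4 := by
  obtain ⟨d, rfl⟩ := hn
  rw [mul_comm, mul_smul]
  refine zsmul_mem ?_ d
  have hm : ∀ a : F, MonoidAlgebra.of ℤ F a - 1 ∈ augIdeal F ^ 1 := fun a => by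
    rw [Submodule.pow_one]; exact of_sub_one_mem_augIdeal _
  obtain ⟨s, hs, c, hc, hsc⟩ := Subgroup.mem_sup_of_normal_left.1 (hR q)
  have h1 := of_zpow_sub_one_sub_mem (hm (x q)) (e q)
  rw [zpow_natCast, ← hsc, of_mul_sub_one] at h1
  have hc' : MonoidAlgebra.of ℤ F c - 1 ∈ augIdeal F ^ 2 := of_sub_one_mem_of_mem_lcs (k := 1) hc
  -- Modulo 𝔣², e_q(x_q - 1) ≡ x_q^{e_q} - 1 = sc - 1 ≡ s - 1, with s in R and c in γ_2.
  have h2 : (e q : ℤ) • (MonoidAlgebra.of ℤ F (x q) - 1) - (MonoidAlgebra.of ℤ F s - 1) ∈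
      augIdeal F ^ 2 := by
    have h3 := sub_mem (add_mem hc' (Ideal.mul_mem_left _ (MonoidAlgebra.of ℤ F s - 1) hc')) h1
    convert h3 using 1
    abel
  have h4 := mul_mem_augIdeal_pow (mul_mem_augIdeal_pow (hm (x p)) h2) (hm (x r))
  have h5 : (MonoidAlgebra.of ℤ F (x p) - 1) * (MonoidAlgebra.of ℤ F s - 1) *
      (MonoidAlgebra.of ℤ F (x r) - 1) ∈ augIdeal F * relIdeal R * augIdeal F :=
    Ideal.mul_mem_mul (Ideal.mul_mem_mul (of_sub_one_mem_augIdeal _)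
      (Ideal.subset_span ⟨s, hs, rfl⟩)) (of_sub_one_mem_augIdeal _)
  have h6 := add_mem (Ideal.mem_sup_right (S := augIdeal F * relIdeal R * augIdeal F) h4)
    (Ideal.mem_sup_left h5)
  convert h6 using 1
  rw [mul_sub _ (_ • _), sub_mul _ _ (MonoidAlgebra.of ℤ F (x r) - 1), sub_add_cancel,
    mul_smul_comm, smul_mul_assoc]

lemma zpow_triple_commutator_mem_D {I : Ideal (MonoidAlgebra ℤ F)} {a b c : F} {n : ℤ}
    (h : n • (((MonoidAlgebra.of ℤ F a - 1) * (MonoidAlgebra.of ℤ F b - 1) -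
          (MonoidAlgebra.of ℤ F b - 1) * (MonoidAlgebra.of ℤ F a - 1)) *
          (MonoidAlgebra.of ℤ F c - 1) -
        (MonoidAlgebra.of ℤ F c - 1) *
          ((MonoidAlgebra.of ℤ F a - 1) * (MonoidAlgebra.of ℤ F b - 1) -
          (MonoidAlgebra.of ℤ F b - 1) * (MonoidAlgebra.of ℤ F a - 1))) ∈ I ⊔ augIdeal F ^ 4) :
    ⁅⁅a, b⁆, c⁆ ^ n ∈ D 4 I := by
  have ht : ⁅⁅a, b⁆, c⁆ ∈ (⊤ : Subgroup F).lowerCentralSeries 2 :=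
    commutator_mem_lcs_succ (commutator_mem_lcs_succ (k := 0) (Subgroup.mem_top _) _) _
  have h1 := of_zpow_sub_one_sub_mem (of_sub_one_mem_of_mem_lcs ht) n
  have h2 := zsmul_mem (of_triple_commutator_sub_one_sub_mem a b c) n
  rw [smul_sub] at h2
  have h3 := add_mem (Ideal.mem_sup_right (S := I) (add_mem h1 h2)) h
  rw [sub_add_sub_cancel, sub_add_cancel] at h3
  exact h3

end Main

end GenDim

theorem mainTheorem8 (m : ℕ) {F : Type*} [Group F] (x : FreeGroupBasis (Fin m) F)
    (e : Fin m → ℕ) (he : ∀ i j : Fin m, i ≤ j → e j ∣ e i)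
    (S : Subgroup F)
    (hS : S = Subgroup.closure
      (Set.range (fun i : Fin m => x i ^ e i) ∪ (GenDim.gamma F 2 : Set F)))
    (R : Subgroup F) [R.Normal] (hR : R ⊔ GenDim.gamma F 2 = S) :
    GenDim.D 4 (GenDim.augIdeal F * GenDim.relIdeal R * GenDim.augIdeal F) =
      Subgroup.closure
        ((GenDim.gamma F 4 : Set F) ∪
          {g : F | ∃ (i j k : Fin m) (n : ℤ), i < j ∧
            (k ≠ j → (e i : ℤ) ∣ n) ∧
            (k = j → (e j : ℤ) ∣ n ∧ (e i : ℤ) ∣ 2 * n) ∧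
            g = ⁅⁅x j, x i⁆, x k⁆ ^ n}) := by
  subst hS
  set H := Subgroup.closure ((GenDim.gamma F 4 : Set F) ∪
          {g : F | ∃ (i j k : Fin m) (n : ℤ), i < j ∧
            (k ≠ j → (e i : ℤ) ∣ n) ∧
            (k = j → (e j : ℤ) ∣ n ∧ (e i : ℤ) ∣ 2 * n) ∧
            g = ⁅⁅x j, x i⁆, x k⁆ ^ n})
  have hRle : R ≤ Subgroup.closure
      (Set.range (fun i : Fin m => x i ^ e i) ∪ (GenDim.gamma F 2 : Set F)) := hR ▸ le_sup_left
  apply le_antisymm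
  · intro g hg
    have hM := fun w => GenDim.dvd_magnusRep_of_mem x hRle w hg
    have hg1 := GenDim.mem_lcs_one_of_magnusEntry x fun w => (hM w).1 0 1 (by simp)
    have hg2 := GenDim.mem_lcs_two_of_magnusEntry x hg1 fun w => (hM w).1 0 2 (by simp)
    have hd : ∀ a b c : Fin m, (e b : ℤ) ∣ GenDim.magnusEntry x ![a, b, c] 0 3 g := fun a b c =>
      (hM ![a, b, c]).2
    refine GenDim.mem_of_lcsClass_mem_closure (k := 2)
      (fun a ha => Subgroup.subset_closure (Or.inl ha)) hg2 ?_
    rw [GenDim.lcsClass_eq_sum x hg2]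
    have hgen : ∀ (i j k : Fin m) (n : ℤ), i < j → (k ≠ j → (e i : ℤ) ∣ n) →
        (k = j → (e j : ℤ) ∣ n ∧ (e i : ℤ) ∣ 2 * n) →
        n • GenDim.lcsClass 2 ⁅⁅x j, x i⁆, x k⁆ ∈ AddSubgroup.closure
          (GenDim.lcsClass 2 '' {a | a ∈ H ∧ a ∈ (⊤ : Subgroup F).lowerCentralSeries 2}) := by
      intro i j k n hij h1 h2
      have hm := GenDim.basis_triple_commutator_mem x j i k
      rw [← (GenDim.isGraded_lcsClass 2).map_zpow hm]
      exact AddSubgroup.subset_closure ⟨_, ⟨Subgroup.subset_closure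
        (Or.inr ⟨i, j, k, n, hij, h1, h2, rfl⟩), zpow_mem hm n⟩, rfl⟩
    refine sum_mem fun ⟨a, b, c⟩ _ => ?_
    rw [GenDim.tripleClass, smul_add]
    refine add_mem ?_ ?_
    · dsimp only
      split_ifs with hbc
      · subst hbc
        rcases lt_trichotomy a b with hab | rfl | hab
        · rw [(GenDim.isGraded_lcsClass 2).map_commutator_swap, smul_neg]
          refine neg_mem (hgen a b b _ hab (fun h => absurd rfl h) fun _ => ⟨hd a b b, ?_⟩)
          -- Twice the exponent is, up to sign, the coefficient at bab, whose middle letter is a.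
          rw [eq_neg_of_add_eq_zero_right (GenDim.magnusEntry_symm x hg2 a b)]
          exact (hd b a b).neg_right
        · rw [commutatorElement_self, commutatorElement_one_left,
            (GenDim.isGraded_lcsClass 2).map_one, smul_zero]
          exact zero_mem _
        · exact hgen b a b _ hab (fun _ => hd a b b) fun h => absurd h hab.ne
      · rw [smul_zero]; exact zero_mem _
    · dsimp only
      split_ifs with habc
      · exact hgen b c a _ habc.2.1 (fun _ => hd a b c) fun h => absurd h habc.1.ne
      · rw [smul_zero]; exact zero_mem _
  · rw [Subgroup.closure_le]
    have hxR : ∀ i, x i ^ e i ∈ R ⊔ GenDim.gamma F 2 := fun i => by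
      rw [hR]; exact Subgroup.subset_closure (Or.inl ⟨i, rfl⟩)
    rintro g (hg | ⟨i, j, k, n, hij, h1, h2, rfl⟩)
    · exact Ideal.mem_sup_right (GenDim.of_sub_one_mem_of_mem_lcs (k := 3) hg)
    · apply GenDim.zpow_triple_commutator_mem_D
      have hz := fun n p q r hn => GenDim.zsmul_mul_mul_mem x hxR (n := n) p q r hn
      by_cases hkj : k = j
      · subst hkj
        obtain ⟨h3, h4⟩ := h2 rfl
        -- With Y = x_k - 1 and X = x_i - 1, the bracket is 2YXY - XYY - YYX: only the word with
        -- middle letter X carries the factor 2.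
        have h5 := sub_mem (sub_mem (hz _ k i k h4) (hz _ i k k h3)) (hz _ k k i h3)
        convert h5 using 1
        generalize MonoidAlgebra.of ℤ F (x i) - 1 = X
        generalize MonoidAlgebra.of ℤ F (x k) - 1 = Y
        simp only [mul_sub, sub_mul, mul_assoc]
        module
      · have hi := h1 hkj
        -- The monomials have middle letters i and j; the divisibility chain covers those with j.
        have hj : (e j : ℤ) ∣ n := (Int.natCast_dvd_natCast.2 (he i j hij.le)).trans hi
        have h5 := add_mem (sub_mem (sub_mem (hz _ j i k hi) (hz _ i j k hj)) (hz _ k j i hj))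
          (hz _ k i j hi)
        convert h5 using 1
        generalize MonoidAlgebra.of ℤ F (x i) - 1 = X
        generalize MonoidAlgebra.of ℤ F (x j) - 1 = Y
        generalize MonoidAlgebra.of ℤ F (x k) - 1 = Z
        simp only [mul_sub, sub_mul, mul_assoc]
        module
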